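/- Let $p,\sigma\in\mathbb C$ with $|p|<1$, put $q=e^{2\pi i\sigma}$ and $q^{s}=e^{2\pi i\sigma s}$ for $s\in\mathbb C$, and let $a,b,z\in\mathbb C$ with $a,b\neq 0$. For $x\ne 0$ let $\theta(x;p)=\prod_{j\ge 0}(1-p^jx)(1-p^{j+1}/x)$ and write $\theta(x_1,\dots,x_m;p)=\theta(x_1;p)\cdots\theta(x_m;p)$. Define, for $k\in\mathbb Z$ and $z\in\mathbb C$, $$w_{a,b;q,p}(k)=\frac{\theta(aq^{2k+1},bq^{k},aq^{k-2}/b;p)}{\theta(aq^{2k-1},bq^{k+2},aq^{k}/b;p)}\,q,\qquad [z]_{a,b;q,p}=\frac{\theta(q^z,aq^z,bq^2,a/b;p)}{\theta(q,aq,bq^{z+1},aq^{z-1}/b;p)}.$$ Let $n\ge 0$, let $0\le b_1\le b_2\le\dots\le b_n\le n$ be integers, and let $B=B(b_1,\dots,b_n)=\{(i,j): 1\le i\le n,\ 1\le j\le b_i\}$ be the corresponding Ferrers board, where $(i,j)$ is the cell in column $i$ from the left and row $j$ from the bottom. A file placement of $k$ rooks in $B$ is a $k$-element subset $Q\subseteq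 B$ with no two cells in the same column. A rook in $Q$ cancels all cells below it in its column, and $U_B(Q)$ denotes the set of cells of $B\setminus Q$ that are not cancelled by any rook of $Q$. The elliptic file numbers are $$f_k(a,b;q,p;B)=\sum_{Q}\ \prod_{(i,j)\in U_B(Q)}w_{a,b;q,p}(1-j),$$ where $Q$ runs over all file placements of $k$ rooks in $B$. Assume that the parameters are generic in the sense that the denominators of $[z]_{a,b;q,p}$ and of the weights $w_{a,b;q,p}(1-j)$, $(i,j)\in B$, do not vanish. Then $$\prod_{i=1}^n\,[z+b_i]_{aq^{-2b_i},\,bq^{-b_i};q,p}=\sum_{k=0}^n f_{n-k}(a,b;q,p;B)\,\bigl([z]_{a,b;q,p}\bigr)^k .$$ -/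

import Mathlib

open Finset

noncomputable section

namespace EllipticFile

/-- The modified Jacobi theta function with nome `p` (used for `‖p‖ < 1` and `x ≠ 0`). -/
def theta (x p : ℂ) : ℂ :=
  ∏' j : ℕ, ((1 - p ^ j * x) * (1 - p ^ (j + 1) / x))

/-- The power `q ^ s = exp (2 π i σ s)` of the base `q = exp (2 π i σ)`.  Letting `σ` range over
all complex numbers covers every nonzero base and every branch of its complex powers. -/
def qpow (σ s : ℂ) : ℂ :=
  Complex.exp (2 * (Real.pi : ℂ) * Complex.I * σ * s)

/-- The denominator of the small elliptic weight `w_{a,b;q,p}(s,t)`, where `q = qpow σ 1`. -/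
def smallWeightDenom (a b σ p : ℂ) (s t : ℤ) : ℂ :=
  theta (a * qpow σ (s + 2 * t - 2)) p *
    theta (b * qpow σ (2 * s + t)) p *
    theta (a * qpow σ (t - s + 1) / b) p

/-- The small elliptic weight `w_{a,b;q,p}(s,t)`, where `q = qpow σ 1`. -/
def smallWeight (a b σ p : ℂ) (s t : ℤ) : ℂ :=
  (theta (a * qpow σ (s + 2 * t)) p *
      theta (b * qpow σ (2 * s + t - 2)) p *
      theta (a * qpow σ (t - s - 1) / b) p) /
    smallWeightDenom a b σ p s t * qpow σ 1

/-- The denominator of the elliptic number `[z]_{a,b;q,p}`, where `q = qpow σ 1`. -/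
def ellNumberDenom (a b σ p z : ℂ) : ℂ :=
  theta (qpow σ 1) p * theta (a * qpow σ 1) p *
    theta (b * qpow σ (z + 1)) p * theta (a * qpow σ (z - 1) / b) p

/-- The elliptic number `[z]_{a,b;q,p}`, where `q = qpow σ 1`. -/
def ellNumber (a b σ p z : ℂ) : ℂ :=
  (theta (qpow σ z) p * theta (a * qpow σ z) p *
      theta (b * qpow σ 2) p * theta (a / b) p) /
    ellNumberDenom a b σ p z

/-- The set of cells `B(b₁, …, bₙ) = {(i, j) : 1 ≤ i ≤ n, 1 ≤ j ≤ bᵢ}`; the cell `(i, j)` is in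
column `i` from the left and row `j` from the bottom.  The height `bᵢ` is `b (i - 1)` here. -/
def board {n : ℕ} (b : Fin n → ℕ) : Finset (ℕ × ℕ) :=
  univ.biUnion fun i : Fin n => (Icc 1 (b i)).image fun j => ((i : ℕ) + 1, j)

/-- The file placements of `k` rooks in `B`: the `k`-subsets of `B` with no two distinct cells in
the same column. -/
def filePlacements (B : Finset (ℕ × ℕ)) (k : ℕ) : Finset (Finset (ℕ × ℕ)) :=
  {Q ∈ B.powersetCard k | ∀ c ∈ Q, ∀ d ∈ Q, c.1 = d.1 → c = d}

/-- The uncancelled cells of `B` outside `Q`: a rook cancels the cells below it in its column. -/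
def uncancelled (B Q : Finset (ℕ × ℕ)) : Finset (ℕ × ℕ) :=
  {c ∈ B | c ∉ Q ∧ ∀ r ∈ Q, ¬ (r.1 = c.1 ∧ c.2 < r.2)}

/-- The elliptic file number `f_k(a,b;q,p;B)`; the weight of the cell `(i, j)` is
`w_{a,b;q,p}(1 - j) = w_{a,b;q,p}(1, 1 - j)`. -/
def fileNumber (a b σ p : ℂ) (B : Finset (ℕ × ℕ)) (k : ℕ) : ℂ :=
  ∑ Q ∈ filePlacements B k, ∏ c ∈ uncancelled B Q, smallWeight a b σ p 1 (1 - (c.2 : ℤ))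

end EllipticFile

end

/-!
Expand the right-hand side column by column. A file placement chooses independently, in every
column, either the row of a rook or no rook (`allFilePlacements_board`), and the uncancelled cells
of a column are those above its rook (`uncancelled_rooks`), so the generating function of the file
numbers is a product over the columns (`sum_fileNumber`). It remains to show that a column of
height `m` contributes `E m = [z + m]` with parameters `a q ^ (-2 m)` and `b q ^ (-m)`
(`columnNumber_eq_sum`). Looking at the top cell of the column, this is the recursion
`E (m + 1) = w (-m) * E m + 1` (`columnNumber_succ`), which after clearing denominators is an
instance of the Weierstrass–Riemann addition formula for `theta` (`theta_addition`). All factors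
to be cleared occur in the denominator of `[z]` or in those of the weights of cells in the column,
so they do not vanish.

The addition formula is proved from the Jacobi triple product (`hasSum_thetaTerm`), which follows
from its finite form (`hasSum_thetaTrunc`) by dominated convergence. Multiplying the series of
`theta (x * y)` and `theta (x / y)` and sorting the double sum by the parity of the exponent of `x`
gives `theta (x * y) * theta (x / y) = C * x * (g x * f y - f x * g y)` for two functions `f`, `g`
and a constant `C` (`theta_mul_theta`), and the addition formula becomes the Plücker relation
between `2 × 2` minors. The series manipulations divide by powers of `p`; for `p = 0` one has
`theta x 0 = 1 - x` and the addition formula is a polynomial identity.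
-/

namespace EllipticFile

open Filter Topology

/-! ### The Jacobi triple product -/

/-- The finite product `(p; p)_n = ∏_{j < n} (1 - p ^ (j + 1))`. -/
noncomputable def eulerProd (p : ℂ) (n : ℕ) : ℂ :=
  ∏ j ∈ range n, (1 - p ^ (j + 1))

/-- The reciprocal `1 / (p; p)_n` for integer `n`, with the usual convention that it vanishes for
negative `n`. -/
noncomputable def invEulerProd (p : ℂ) (n : ℤ) : ℂ :=
  if 0 ≤ n then (eulerProd p n.toNat)⁻¹ else 0

/-- The infinite product `(p; p)_∞`. -/
noncomputable def eulerInf (p : ℂ) : ℂ :=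
  ∏' j : ℕ, (1 - p ^ (j + 1))

/-- The truncation to the indices `j < N` of the product defining `theta`. -/
noncomputable def thetaTrunc (x p : ℂ) (N : ℕ) : ℂ :=
  ∏ j ∈ range N, ((1 - p ^ j * x) * (1 - p ^ (j + 1) / x))

/-- The general term of the theta series `∑ₖ s ^ (k (k - 1)) x ^ k`. With `p = s ^ 2` its first
factor is `p ^ (k choose 2)`; the square root `s` of the nome avoids halving exponents. -/
noncomputable def thetaTerm (s x : ℂ) (k : ℤ) : ℂ :=
  s ^ (k * (k - 1)) * x ^ k

lemma one_sub_pow_succ_ne_zero {p : ℂ} (hp : ‖p‖ < 1) (n : ℕ) : 1 - p ^ (n + 1) ≠ 0 := by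
  intro h
  have h1 : ‖p ^ (n + 1)‖ = 1 := by rw [← sub_eq_zero.mp h, norm_one]
  rw [norm_pow] at h1
  exact absurd h1 (pow_lt_one₀ (norm_nonneg _) hp (Nat.succ_ne_zero n)).ne

lemma eulerProd_ne_zero {p : ℂ} (hp : ‖p‖ < 1) (n : ℕ) : eulerProd p n ≠ 0 :=
  prod_ne_zero_iff.mpr fun j _ => one_sub_pow_succ_ne_zero hp j

lemma summable_norm_pow_mul {p : ℂ} (hp : ‖p‖ < 1) (c : ℂ) :
    Summable fun j : ℕ => ‖-(p ^ j * c)‖ := by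
  simp only [norm_neg, norm_mul, norm_pow]
  exact (summable_geometric_of_lt_one (norm_nonneg _) hp).mul_right _

lemma multipliable_one_sub_pow_mul {p : ℂ} (hp : ‖p‖ < 1) (c : ℂ) :
    Multipliable fun j : ℕ => 1 - p ^ j * c := by
  simpa only [sub_eq_add_neg] using multipliable_one_add_of_summable (summable_norm_pow_mul hp c)

lemma tendsto_eulerProd {p : ℂ} (hp : ‖p‖ < 1) :
    Tendsto (eulerProd p) atTop (𝓝 (eulerInf p)) := by
  have h := (multipliable_one_sub_pow_mul hp p).hasProd.tendsto_prod_nat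
  simp only [← pow_succ] at h
  exact h

lemma eulerInf_ne_zero {p : ℂ} (hp : ‖p‖ < 1) : eulerInf p ≠ 0 := by
  have h := tprod_one_add_ne_zero_of_summable (f := fun j : ℕ => -(p ^ j * p))
    (fun j => by
      rw [← sub_eq_add_neg, ← pow_succ]
      exact one_sub_pow_succ_ne_zero hp j) (summable_norm_pow_mul hp p)
  simpa only [eulerInf, ← sub_eq_add_neg, ← pow_succ] using h

lemma tendsto_thetaTrunc {p : ℂ} (hp : ‖p‖ < 1) (x : ℂ) :
    Tendsto (thetaTrunc x p) atTop (𝓝 (theta x p)) := by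
  have h := ((multipliable_one_sub_pow_mul hp x).mul
    (multipliable_one_sub_pow_mul hp (p / x))).hasProd.tendsto_prod_nat
  simp only [← mul_div_assoc, ← pow_succ] at h
  exact h

lemma invEulerProd_natCast (p : ℂ) (n : ℕ) : invEulerProd p n = (eulerProd p n)⁻¹ := by
  simp [invEulerProd]

/-- The recursion `1 / (p; p)_n = (1 - p ^ (n + 1)) / (p; p)_{n + 1}` extends to all integers: at
`n = -1` the factor `1 - p ^ 0` vanishes. -/
lemma invEulerProd_eq {p : ℂ} (hp : ‖p‖ < 1) (n : ℤ) :
    invEulerProd p n = (1 - p ^ (n + 1)) * invEulerProd p (n + 1) := by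
  rcases lt_trichotomy n (-1) with h | rfl | h
  · simp [invEulerProd, show ¬ 0 ≤ n by omega, show ¬ 0 ≤ n + 1 by omega]
  · simp [invEulerProd]
  · lift n to ℕ using by omega
    have h1 := one_sub_pow_succ_ne_zero hp n
    have h2 := eulerProd_ne_zero hp n
    have h3 : eulerProd p (n + 1) = eulerProd p n * (1 - p ^ (n + 1)) := prod_range_succ _ _
    rw [show ((n : ℤ) + 1) = ((n + 1 : ℕ) : ℤ) by push_cast; ring, invEulerProd_natCast,
      invEulerProd_natCast, zpow_natCast, h3]
    field_simp

/-- The coefficient in the finite triple product is the `p`-binomial coefficient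
`(p; p)_{2N} / ((p; p)_{N + k} (p; p)_{N - k})`. -/
noncomputable def tripleCoeff (p : ℂ) (N : ℕ) (k : ℤ) : ℂ :=
  eulerProd p (2 * N) * (invEulerProd p (N + k) * invEulerProd p (N - k))

/-- The recursion comes from multiplying the truncated product by
`(1 - p ^ N x) (1 - p ^ (N + 1) / x) = 1 + p ^ (2 N + 1) - p ^ N x - p ^ (N + 1) / x`. -/
lemma tripleCoeff_succ {p : ℂ} (hp0 : p ≠ 0) (hp : ‖p‖ < 1) (N : ℕ) (k : ℤ) :
    tripleCoeff p (N + 1) k =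
      (1 + p ^ (2 * N + 1)) * tripleCoeff p N k
        + p ^ ((N : ℤ) - k + 1) * tripleCoeff p N (k - 1)
        + p ^ ((N : ℤ) + k + 1) * tripleCoeff p N (k + 1) := by
  have hE : eulerProd p (2 * (N + 1)) =
      eulerProd p (2 * N) * (1 - p ^ (2 * N + 1)) * (1 - p ^ (2 * N + 2)) := by
    rw [show 2 * (N + 1) = 2 * N + 1 + 1 by ring, eulerProd, prod_range_succ, prod_range_succ]
    rfl
  -- All four coefficients are multiples of
  -- `(p; p)_{2N} / ((p; p)_{A + 1} (p; p)_{B + 1})`.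
  obtain ⟨A, hA⟩ : ∃ A : ℤ, A = N + k := ⟨_, rfl⟩
  obtain ⟨B, hB⟩ : ∃ B : ℤ, B = N - k := ⟨_, rfl⟩
  have hAB : p ^ (2 * N) = p ^ A * p ^ B := by
    rw [← zpow_add₀ hp0, ← zpow_natCast]
    congr 1
    push_cast
    omega
  have e1 := invEulerProd_eq hp A
  have e2 := invEulerProd_eq hp B
  have e3 := invEulerProd_eq hp (A - 1)
  have e4 := invEulerProd_eq hp (B - 1)
  rw [sub_add_cancel] at e3 e4
  have i1 : ((N + 1 : ℕ) : ℤ) + k = A + 1 := by push_cast; omega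
  have i2 : ((N + 1 : ℕ) : ℤ) - k = B + 1 := by push_cast; omega
  have i3 : (N : ℤ) + (k - 1) = A - 1 := by omega
  have i4 : (N : ℤ) - (k - 1) = B + 1 := by omega
  have i5 : (N : ℤ) + (k + 1) = A + 1 := by omega
  have i6 : (N : ℤ) - (k + 1) = B - 1 := by omega
  simp only [tripleCoeff, hE, i1, i2, i3, i4, i5, i6, ← hA, ← hB]
  rw [e3, e4, e1, e2, pow_succ p (2 * N + 1), pow_succ p (2 * N), hAB,
    zpow_add_one₀ hp0, zpow_add_one₀ hp0]
  ring

lemma thetaTerm_succ {s x : ℂ} (hs0 : s ≠ 0) (hx : x ≠ 0) (k : ℤ) :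
    thetaTerm s x (k + 1) = (s ^ 2) ^ k * x * thetaTerm s x k := by
  rw [thetaTerm, thetaTerm, zpow_add_one₀ hx,
    show (k + 1) * (k + 1 - 1) = (2 : ℕ) * k + k * (k - 1) by push_cast; ring, zpow_add₀ hs0,
    zpow_mul, zpow_natCast]
  ring

lemma thetaTerm_ne_zero {s x : ℂ} (hs0 : s ≠ 0) (hx : x ≠ 0) (k : ℤ) : thetaTerm s x k ≠ 0 :=
  mul_ne_zero (zpow_ne_zero _ hs0) (zpow_ne_zero _ hx)

/-- The finite triple product, as a series over `ℤ` with finitely many nonzero terms. -/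
lemma hasSum_thetaTrunc {s x : ℂ} (hs0 : s ≠ 0) (hs : ‖s ^ 2‖ < 1) (hx : x ≠ 0) (N : ℕ) :
    HasSum (fun k : ℤ => tripleCoeff (s ^ 2) N k * thetaTerm s (-x) k)
      (thetaTrunc x (s ^ 2) N) := by
  induction N with
  | zero =>
    have h := hasSum_single (f := fun k : ℤ => tripleCoeff (s ^ 2) 0 k * thetaTerm s (-x) k) 0
      (fun k hk => by
        have hzero : invEulerProd (s ^ 2) k * invEulerProd (s ^ 2) (-k) = 0 := by
          rcases lt_or_gt_of_ne hk with h | h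
          · rw [invEulerProd, if_neg (by omega), zero_mul]
          · rw [mul_comm, invEulerProd, if_neg (by omega), zero_mul]
        simp [tripleCoeff, hzero])
    simpa [tripleCoeff, invEulerProd, eulerProd, thetaTerm, thetaTrunc] using h
  | succ N ih =>
    have hp0 : s ^ 2 ≠ 0 := pow_ne_zero 2 hs0
    have hx' : -x ≠ 0 := neg_ne_zero.mpr hx
    have hdown := ((Equiv.addRight (-1 : ℤ)).hasSum_iff.mpr ih).mul_left ((s ^ 2) ^ N * -x)
    have hup := ((Equiv.addRight (1 : ℤ)).hasSum_iff.mpr ih).mul_left ((s ^ 2) ^ (N + 1) / -x)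
    have hsum := ((ih.mul_left (1 + (s ^ 2) ^ (2 * N + 1))).add hdown).add hup
    have hval : thetaTrunc x (s ^ 2) (N + 1) =
        (1 + (s ^ 2) ^ (2 * N + 1)) * thetaTrunc x (s ^ 2) N
          + (s ^ 2) ^ N * -x * thetaTrunc x (s ^ 2) N
          + (s ^ 2) ^ (N + 1) / -x * thetaTrunc x (s ^ 2) N := by
      rw [thetaTrunc, prod_range_succ, ← thetaTrunc]
      field_simp
      ring
    rw [hval]
    refine Eq.mpr (congrArg (HasSum · _) (funext fun k => ?_)) hsum
    have e1 := thetaTerm_succ hs0 hx' k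
    have e2 := thetaTerm_succ hs0 hx' (k - 1)
    rw [sub_add_cancel] at e2
    have e3 : (s ^ 2) ^ ((N : ℤ) - k + 1) * thetaTerm s (-x) k =
        (s ^ 2) ^ N * -x * thetaTerm s (-x) (k - 1) := by
      rw [e2, ← mul_assoc, ← mul_assoc, ← zpow_add₀ hp0, ← zpow_natCast (s ^ 2) N]
      congr 3
      ring
    have e4 : (s ^ 2) ^ ((N : ℤ) + k + 1) * thetaTerm s (-x) k =
        (s ^ 2) ^ (N + 1) / -x * thetaTerm s (-x) (k + 1) := by
      rw [e1, show (N : ℤ) + k + 1 = ((N + 1 : ℕ) : ℤ) + k by push_cast; ring,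
        zpow_add₀ hp0, zpow_natCast]
      field_simp
    simp only [Function.comp_apply, Equiv.coe_addRight, ← sub_eq_add_neg]
    rw [tripleCoeff_succ hp0 hs]
    linear_combination tripleCoeff (s ^ 2) N (k - 1) * e3 + tripleCoeff (s ^ 2) N (k + 1) * e4

lemma summable_norm_thetaTerm {s x : ℂ} (hs0 : s ≠ 0) (hs : ‖s‖ < 1) (hx : x ≠ 0) :
    Summable fun k : ℤ => ‖thetaTerm s x k‖ := by
  have hnat : ∀ y : ℂ, y ≠ 0 → Summable fun n : ℕ => ‖thetaTerm s y n‖ := by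
    intro y hy
    refine summable_of_ratio_test_tendsto_lt_one zero_lt_one
      (Eventually.of_forall fun n => norm_ne_zero_iff.mpr (thetaTerm_ne_zero hs0 hy n)) ?_
    have hs2 : ‖s‖ ^ 2 < 1 := pow_lt_one₀ (norm_nonneg _) hs two_ne_zero
    have hlim := (tendsto_pow_atTop_nhds_zero_of_lt_one (by positivity) hs2).mul_const ‖y‖
    rw [zero_mul] at hlim
    refine hlim.congr fun n => ?_
    have hn := norm_ne_zero_iff.mpr (thetaTerm_ne_zero hs0 hy n)
    rw [norm_norm, norm_norm, Nat.cast_succ, thetaTerm_succ hs0 hy, norm_mul,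
      mul_div_cancel_right₀ _ hn, norm_mul, zpow_natCast, norm_pow, norm_pow]
  refine Summable.of_nat_of_neg (hnat x hx) ?_
  have hneg := ((summable_nat_add_iff 1).mpr (hnat x⁻¹ (inv_ne_zero hx))).mul_right ‖x‖
  refine hneg.congr fun n => ?_
  rw [← norm_mul, thetaTerm, thetaTerm, mul_assoc]
  congr 2
  · congr 1
    push_cast
    ring
  · rw [Nat.cast_succ, zpow_add_one₀ (inv_ne_zero hx), mul_assoc, inv_mul_cancel₀ hx, mul_one,
      inv_zpow, zpow_neg]

/-- **Jacobi triple product**, for the nome `s ^ 2`. -/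
theorem hasSum_thetaTerm {s x : ℂ} (hs0 : s ≠ 0) (hs : ‖s‖ < 1) (hx : x ≠ 0) :
    HasSum (thetaTerm s (-x)) (eulerInf (s ^ 2) * theta x (s ^ 2)) := by
  have hp : ‖s ^ 2‖ < 1 := by
    rw [norm_pow]
    exact pow_lt_one₀ (norm_nonneg _) hs two_ne_zero
  have hE := eulerInf_ne_zero hp
  have hinv : Tendsto (fun n : ℕ => (eulerProd (s ^ 2) n)⁻¹) atTop (𝓝 (eulerInf (s ^ 2))⁻¹) :=
    (tendsto_eulerProd hp).inv₀ hE
  have hinvZ : Tendsto (invEulerProd (s ^ 2)) atTop (𝓝 (eulerInf (s ^ 2))⁻¹) := by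
    have htoNat : Tendsto Int.toNat atTop atTop :=
      tendsto_atTop_mono' _ (f₁ := Int.toNat) (Eventually.of_forall fun _ => le_rfl)
        (tendsto_atTop_atTop.mpr fun n => ⟨n, fun m hm => by omega⟩)
    refine (hinv.comp htoNat).congr' ?_
    filter_upwards [eventually_ge_atTop 0] with n hn
    simp [invEulerProd, hn]
  obtain ⟨C, hC⟩ := (Metric.isBounded_range_of_tendsto _ (tendsto_eulerProd hp)).exists_norm_le
  obtain ⟨D, hD⟩ := (Metric.isBounded_range_of_tendsto _ hinv).exists_norm_le
  have hC0 : 0 ≤ C := (norm_nonneg _).trans (hC _ ⟨0, rfl⟩)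
  have hD0 : 0 ≤ D := (norm_nonneg _).trans (hD _ ⟨0, rfl⟩)
  have hinvD : ∀ n, ‖invEulerProd (s ^ 2) n‖ ≤ D := by
    intro n
    rw [invEulerProd]
    split_ifs
    · exact hD _ ⟨_, rfl⟩
    · simpa using hD0
  have hcoeff : ∀ k : ℤ, Tendsto (fun N : ℕ => tripleCoeff (s ^ 2) N k) atTop
      (𝓝 (eulerInf (s ^ 2))⁻¹) := by
    intro k
    have h1 : Tendsto (fun N : ℕ => 2 * N) atTop atTop :=
      tendsto_id.const_mul_atTop' two_pos
    have h2 : Tendsto (fun N : ℕ => (N : ℤ) + k) atTop atTop :=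
      tendsto_atTop_add_const_right _ _ tendsto_natCast_atTop_atTop
    have h3 : Tendsto (fun N : ℕ => (N : ℤ) - k) atTop atTop :=
      tendsto_atTop_add_const_right _ _ tendsto_natCast_atTop_atTop
    have h4 := ((tendsto_eulerProd hp).comp h1).mul ((hinvZ.comp h2).mul (hinvZ.comp h3))
    rwa [mul_inv_cancel_left₀ hE] at h4
  have hsummable := summable_norm_thetaTerm hs0 hs (neg_ne_zero.mpr hx)
  have hlim : Tendsto (fun N : ℕ => ∑' k : ℤ, tripleCoeff (s ^ 2) N k * thetaTerm s (-x) k) atTop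
      (𝓝 (∑' k : ℤ, (eulerInf (s ^ 2))⁻¹ * thetaTerm s (-x) k)) := by
    -- The coefficients `tripleCoeff` are bounded uniformly in `N` and `k`.
    refine tendsto_tsum_of_dominated_convergence (hsummable.mul_left (C * (D * D)))
      (fun k => (hcoeff k).mul_const _) (Eventually.of_forall fun N k => ?_)
    rw [tripleCoeff, norm_mul, norm_mul, norm_mul]
    gcongr
    · exact hC _ ⟨_, rfl⟩
    · exact hinvD _
    · exact hinvD _
  have heq : theta x (s ^ 2) = (eulerInf (s ^ 2))⁻¹ * ∑' k : ℤ, thetaTerm s (-x) k := by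
    rw [← tsum_mul_left]
    refine tendsto_nhds_unique (tendsto_thetaTrunc hp x) (hlim.congr fun N => ?_)
    exact (hasSum_thetaTrunc hs0 hp hx N).tsum_eq
  rw [heq, mul_inv_cancel_left₀ hE]
  exact hsummable.of_norm.hasSum

/-! ### The addition formula for theta functions -/

/-- `∑ₖ p ^ (k ^ 2) y ^ (2 k)`, one of the two functions spanning the theta functions of order
two that arise from `theta (x * y) p * theta (x / y) p`. -/
noncomputable def evenTheta (p y : ℂ) : ℂ := ∑' k : ℤ, p ^ (k * k) * y ^ (2 * k)

/-- `∑ₖ p ^ (k (k + 1)) y ^ (2 k + 1)`, the other function of the pair. -/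
noncomputable def oddTheta (p y : ℂ) : ℂ := ∑' k : ℤ, p ^ (k * (k + 1)) * y ^ (2 * k + 1)

lemma summable_norm_evenTheta {p y : ℂ} (hp0 : p ≠ 0) (hp : ‖p‖ < 1) (hy : y ≠ 0) :
    Summable fun k : ℤ => ‖p ^ (k * k) * y ^ (2 * k)‖ := by
  have h := summable_norm_thetaTerm hp0 hp (mul_ne_zero hp0 (pow_ne_zero 2 hy))
  refine h.congr fun k => ?_
  rw [thetaTerm, mul_zpow, ← zpow_natCast y 2, ← zpow_mul, ← mul_assoc, ← zpow_add₀ hp0]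
  congr 4
  ring

lemma summable_norm_oddTheta {p y : ℂ} (hp0 : p ≠ 0) (hp : ‖p‖ < 1) (hy : y ≠ 0) :
    Summable fun k : ℤ => ‖p ^ (k * (k + 1)) * y ^ (2 * k + 1)‖ := by
  have h := (summable_norm_thetaTerm hp0 hp
    (mul_ne_zero (pow_ne_zero 2 hp0) (pow_ne_zero 2 hy))).mul_right ‖y‖
  refine h.congr fun k => ?_
  rw [← norm_mul, thetaTerm, mul_zpow, ← zpow_natCast y 2, ← zpow_mul, ← mul_assoc,
    ← zpow_natCast p 2, ← zpow_mul, ← zpow_add₀ hp0, mul_assoc, ← zpow_add_one₀ hy]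
  congr 3
  push_cast
  ring

/-- The pairs `(m, n)` of integers, sorted by the parity of `m + n`: with `t = (i, j)`, the sum
`m + n` is `2 i + 2` or `2 i + 1`, and the difference `m - n` is `2 j` or `2 j + 1`. -/
lemma bijective_parity_split : Function.Bijective
    (Sum.elim (fun t : ℤ × ℤ => (t.1 + t.2 + 1, t.1 - t.2 + 1))
      (fun t : ℤ × ℤ => (t.1 + t.2 + 1, t.1 - t.2))) := by
  constructor
  · rintro (⟨i, j⟩ | ⟨i, j⟩) (⟨k, l⟩ | ⟨k, l⟩) h <;>
      simp only [Sum.elim_inl, Sum.elim_inr, Prod.mk.injEq, Sum.inl.injEq, Sum.inr.injEq,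
        reduceCtorEq] at h ⊢ <;> omega
  · rintro ⟨m, n⟩
    rcases Int.even_or_odd' (m + n) with ⟨c, hc | hc⟩
    · exact ⟨Sum.inl (c - 1, m - c), by simp only [Sum.elim_inl, Prod.mk.injEq]; omega⟩
    · exact ⟨Sum.inr (c, m - c - 1), by simp only [Sum.elim_inr, Prod.mk.injEq]; omega⟩

lemma hasSum_mul_of_summable_norm {f g : ℤ → ℂ} (hf : Summable fun k => ‖f k‖)
    (hg : Summable fun k => ‖g k‖) :
    HasSum (fun t : ℤ × ℤ => f t.1 * g t.2) ((∑' k, f k) * ∑' k, g k) :=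
  HasSum.mul hf.of_norm.hasSum hg.of_norm.hasSum (summable_mul_of_summable_norm hf hg)

lemma hasSum_of_parity_split {f : ℤ × ℤ → ℂ} {c d : ℂ}
    (hc : HasSum (fun t : ℤ × ℤ => f (t.1 + t.2 + 1, t.1 - t.2 + 1)) c)
    (hd : HasSum (fun t : ℤ × ℤ => f (t.1 + t.2 + 1, t.1 - t.2)) d) : HasSum f (c + d) :=
  (Equiv.ofBijective _ bijective_parity_split).hasSum_iff.mp (HasSum.sum hc hd)

lemma thetaTerm_mul_thetaTerm {s x y : ℂ} (hs0 : s ≠ 0) (hx : x ≠ 0) (hy : y ≠ 0) (m n : ℤ) :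
    thetaTerm s (-(x * y)) m * thetaTerm s (-(x / y)) n =
      s ^ (m * (m - 1) + n * (n - 1)) * ((-x) ^ (m + n) * y ^ (m - n)) := by
  rw [thetaTerm, thetaTerm, ← neg_mul, ← neg_div, mul_zpow, div_zpow, zpow_add₀ hs0,
    zpow_add₀ (neg_ne_zero.mpr hx), zpow_sub₀ hy]
  ring

lemma thetaTerm_mul_thetaTerm_even {s x y : ℂ} (hs0 : s ≠ 0) (hx : x ≠ 0) (hy : y ≠ 0)
    (i j : ℤ) :
    thetaTerm s (-(x * y)) (i + j + 1) * thetaTerm s (-(x / y)) (i - j + 1) =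
      x * ((s ^ 2) ^ (i * (i + 1)) * x ^ (2 * i + 1) * ((s ^ 2) ^ (j * j) * y ^ (2 * j))) := by
  rw [thetaTerm_mul_thetaTerm hs0 hx hy, ← zpow_natCast s 2, ← zpow_mul, ← zpow_mul,
    show i + j + 1 + (i - j + 1) = 2 * i + 1 + 1 by ring,
    show i + j + 1 - (i - j + 1) = 2 * j by ring,
    Even.neg_zpow ⟨i + 1, by ring⟩, zpow_add_one₀ hx (2 * i + 1),
    show (i + j + 1) * (i + j + 1 - 1) + (i - j + 1) * (i - j + 1 - 1) =
      ((2 : ℕ) : ℤ) * (i * (i + 1)) + ((2 : ℕ) : ℤ) * (j * j) by push_cast; ring, zpow_add₀ hs0]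
  ring

lemma thetaTerm_mul_thetaTerm_odd {s x y : ℂ} (hs0 : s ≠ 0) (hx : x ≠ 0) (hy : y ≠ 0)
    (i j : ℤ) :
    thetaTerm s (-(x * y)) (i + j + 1) * thetaTerm s (-(x / y)) (i - j) =
      -x * ((s ^ 2) ^ (i * i) * x ^ (2 * i) *
        ((s ^ 2) ^ (j * (j + 1)) * y ^ (2 * j + 1))) := by
  rw [thetaTerm_mul_thetaTerm hs0 hx hy, ← zpow_natCast s 2, ← zpow_mul, ← zpow_mul,
    show i + j + 1 + (i - j) = 2 * i + 1 by ring,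
    show i + j + 1 - (i - j) = 2 * j + 1 by ring,
    Odd.neg_zpow ⟨i, rfl⟩, zpow_add_one₀ hx (2 * i),
    show (i + j + 1) * (i + j + 1 - 1) + (i - j) * (i - j - 1) =
      ((2 : ℕ) : ℤ) * (i * i) + ((2 : ℕ) : ℤ) * (j * (j + 1)) by push_cast; ring, zpow_add₀ hs0]
  ring

/-- The product `theta (x * y) p * theta (x / y) p` is `x` times an alternating form of rank two
in `x` and `y`. -/
theorem theta_mul_theta {p x y : ℂ} (hp0 : p ≠ 0) (hp : ‖p‖ < 1) (hx : x ≠ 0) (hy : y ≠ 0) :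
    eulerInf p ^ 2 * (theta (x * y) p * theta (x / y) p) =
      x * (oddTheta p x * evenTheta p y - evenTheta p x * oddTheta p y) := by
  obtain ⟨s, rfl⟩ := IsAlgClosed.exists_pow_nat_eq p two_pos
  have hs0 : s ≠ 0 := fun h => hp0 (by simp [h])
  have hs : ‖s‖ < 1 := by
    rw [norm_pow] at hp
    exact (pow_lt_one_iff_of_nonneg (norm_nonneg _) two_ne_zero).mp hp
  have hxy := mul_ne_zero hx hy
  have hxdy := div_ne_zero hx hy
  have s1 := summable_norm_thetaTerm hs0 hs (neg_ne_zero.mpr hxy)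
  have s2 := summable_norm_thetaTerm hs0 hs (neg_ne_zero.mpr hxdy)
  have hprod := (hasSum_thetaTerm hs0 hs hxy).mul (hasSum_thetaTerm hs0 hs hxdy)
    (summable_mul_of_summable_norm s1 s2)
  have ex := summable_norm_evenTheta hp0 hp hx
  have ey := summable_norm_evenTheta hp0 hp hy
  have ox := summable_norm_oddTheta hp0 hp hx
  have oy := summable_norm_oddTheta hp0 hp hy
  have h1 := (hasSum_mul_of_summable_norm ox ey).mul_left x
  have h2 := (hasSum_mul_of_summable_norm ex oy).mul_left (-x)
  have hparts : HasSum
      (fun t : ℤ × ℤ => thetaTerm s (-(x * y)) t.1 * thetaTerm s (-(x / y)) t.2)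
      (x * (oddTheta (s ^ 2) x * evenTheta (s ^ 2) y) +
        -x * (evenTheta (s ^ 2) x * oddTheta (s ^ 2) y)) := by
    apply hasSum_of_parity_split
    · simp only [thetaTerm_mul_thetaTerm_even hs0 hx hy]
      exact h1
    · simp only [thetaTerm_mul_thetaTerm_odd hs0 hx hy]
      exact h2
  have huniq := hprod.unique hparts
  linear_combination huniq

/-- The **Weierstrass–Riemann addition formula**. By `theta_mul_theta` it is the Plücker relation
between the `2 × 2` minors formed from `evenTheta p` and `oddTheta p` at four points. -/
theorem theta_addition {p x y u v : ℂ} (hp : ‖p‖ < 1) (hx : x ≠ 0) (hy : y ≠ 0) (hu : u ≠ 0)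
    (hv : v ≠ 0) :
    theta (x * y) p * theta (x / y) p * theta (u * v) p * theta (u / v) p -
        theta (x * v) p * theta (x / v) p * theta (u * y) p * theta (u / y) p =
      u / y * (theta (y * v) p * theta (y / v) p * theta (x * u) p * theta (x / u) p) := by
  rcases eq_or_ne p 0 with rfl | hp0
  · have h0 : ∀ t : ℂ, theta t 0 = 1 - t := by
      intro t
      rw [theta, tprod_eq_mulSingle 0]
      · simp
      · intro j hj
        simp [hj]
    simp only [h0]
    field_simp
    ring
  · have hE := pow_ne_zero 2 (eulerInf_ne_zero hp)
    have hF : ∀ {r t : ℂ}, r ≠ 0 → t ≠ 0 → theta (r * t) p * theta (r / t) p =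
        r * (oddTheta p r * evenTheta p t - evenTheta p r * oddTheta p t) / eulerInf p ^ 2 := by
      intro r t hr ht
      rw [eq_div_iff hE, mul_comm, theta_mul_theta hp0 hp hr ht]
    calc
      _ = theta (x * y) p * theta (x / y) p * (theta (u * v) p * theta (u / v) p) -
          theta (x * v) p * theta (x / v) p * (theta (u * y) p * theta (u / y) p) := by ring
      _ = u / y * (theta (y * v) p * theta (y / v) p * (theta (x * u) p * theta (x / u) p)) := by
        rw [hF hx hy, hF hu hv, hF hx hv, hF hu hy, hF hy hv, hF hx hu]
        field_simp
        ring
      _ = _ := by ring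

/-! ### Powers of the base -/

lemma qpow_ne_zero (σ s : ℂ) : qpow σ s ≠ 0 := Complex.exp_ne_zero _

lemma qpow_add (σ s t : ℂ) : qpow σ (s + t) = qpow σ s * qpow σ t := by
  rw [qpow, qpow, qpow, ← Complex.exp_add, mul_add]

lemma qpow_neg (σ s : ℂ) : qpow σ (-s) = (qpow σ s)⁻¹ := by
  rw [qpow, qpow, ← Complex.exp_neg, mul_neg]

lemma qpow_sub (σ s t : ℂ) : qpow σ (s - t) = qpow σ s / qpow σ t := by
  rw [sub_eq_add_neg, qpow_add, qpow_neg, div_eq_mul_inv]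

lemma qpow_two_mul (σ s : ℂ) : qpow σ (2 * s) = qpow σ s ^ 2 := by
  rw [two_mul, qpow_add, sq]

lemma qpow_two (σ : ℂ) : qpow σ 2 = qpow σ 1 ^ 2 := by
  rw [← qpow_two_mul, mul_one]

/-! ### A single column -/

/-- The elliptic number attached to a column of height `m`. -/
noncomputable def columnNumber (a b σ p z : ℂ) (m : ℕ) : ℂ :=
  ellNumber (a * qpow σ (-2 * (m : ℂ))) (b * qpow σ (-(m : ℂ))) σ p (z + (m : ℂ))

lemma columnNumber_zero (a b σ p z : ℂ) : columnNumber a b σ p z 0 = ellNumber a b σ p z := by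
  simp [columnNumber, show qpow σ 0 = 1 by simp [qpow]]

lemma columnNumber_eq {b : ℂ} (hb : b ≠ 0) (a σ p z : ℂ) (m : ℕ) :
    columnNumber a b σ p z m =
      (theta (qpow σ z * qpow σ m) p * theta (a * qpow σ z / qpow σ m) p *
          theta (b * qpow σ 1 ^ 2 / qpow σ m) p * theta (a / (b * qpow σ m)) p) /
        (theta (qpow σ 1) p * theta (a * qpow σ 1 / qpow σ m ^ 2) p *
          theta (b * qpow σ z * qpow σ 1) p * theta (a * qpow σ z / (qpow σ 1 * b)) p) := by
  have h1 := qpow_ne_zero σ 1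
  have h2 := qpow_ne_zero σ z
  have h3 := qpow_ne_zero σ m
  simp only [columnNumber, ellNumber, ellNumberDenom, neg_mul, qpow_neg, qpow_add, qpow_sub,
    qpow_two_mul, qpow_two]
  refine congrArg₂ (· / ·)
    (congrArg₂ (· * ·) (congrArg₂ (· * ·) (congrArg₂ (· * ·) rfl (congrArg (theta · p) ?_))
      (congrArg (theta · p) ?_)) (congrArg (theta · p) ?_))
    (congrArg₂ (· * ·) (congrArg₂ (· * ·) (congrArg₂ (· * ·) rfl (congrArg (theta · p) ?_))
      (congrArg (theta · p) ?_)) (congrArg (theta · p) ?_)) <;> field_simp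

lemma smallWeightDenom_eq {b : ℂ} (hb : b ≠ 0) (a σ p : ℂ) (m : ℕ) :
    smallWeightDenom a b σ p 1 (1 - ((m + 1 : ℕ) : ℤ)) =
      theta (a / (qpow σ 1 * qpow σ m ^ 2)) p * theta (b * qpow σ 1 ^ 2 / qpow σ m) p *
        theta (a / (b * qpow σ m)) p := by
  have h1 := qpow_ne_zero σ 1
  have h3 := qpow_ne_zero σ m
  rw [smallWeightDenom]
  push_cast
  simp only [mul_one, qpow_add, qpow_sub, qpow_two_mul, qpow_two]
  refine congrArg₂ (· * ·) (congrArg₂ (· * ·) (congrArg (theta · p) ?_)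
    (congrArg (theta · p) ?_)) (congrArg (theta · p) ?_) <;> field_simp

lemma smallWeight_eq {b : ℂ} (hb : b ≠ 0) (a σ p : ℂ) (m : ℕ) :
    smallWeight a b σ p 1 (1 - ((m + 1 : ℕ) : ℤ)) =
      (theta (a * qpow σ 1 / qpow σ m ^ 2) p * theta (b / qpow σ m) p *
          theta (a / (b * qpow σ m * qpow σ 1 ^ 2)) p) /
        (theta (a / (qpow σ 1 * qpow σ m ^ 2)) p * theta (b * qpow σ 1 ^ 2 / qpow σ m) p *
          theta (a / (b * qpow σ m)) p) * qpow σ 1 := by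
  have h1 := qpow_ne_zero σ 1
  have h3 := qpow_ne_zero σ m
  rw [smallWeight, smallWeightDenom_eq hb]
  push_cast
  simp only [mul_one, qpow_add, qpow_sub, qpow_two_mul, qpow_two]
  refine congrArg (· / _ * _) (congrArg₂ (· * ·) (congrArg₂ (· * ·) (congrArg (theta · p) ?_)
    (congrArg (theta · p) ?_)) (congrArg (theta · p) ?_)) <;> field_simp

/-- Placing no rook in the top cell of a column of height `m + 1` contributes the weight of that
cell, and placing a rook there cancels the rest of the column. This is the addition formula with
`x = √a q ^ z`, `y = √a q ^ (-m - 1)`, `u = √a q ^ (-m)` and `v = b q / √a`. -/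
lemma columnNumber_succ {a b σ p z : ℂ} (ha : a ≠ 0) (hb : b ≠ 0) (hp : ‖p‖ < 1)
    (hz : ellNumberDenom a b σ p z ≠ 0) {m : ℕ}
    (hw : ∀ j ∈ Icc 1 (m + 1), smallWeightDenom a b σ p 1 (1 - (j : ℤ)) ≠ 0) :
    columnNumber a b σ p z (m + 1) =
      smallWeight a b σ p 1 (1 - ((m + 1 : ℕ) : ℤ)) * columnNumber a b σ p z m + 1 := by
  have hQ := qpow_ne_zero σ 1
  have hX := qpow_ne_zero σ z
  have hM := qpow_ne_zero σ m
  have hMQ : qpow σ ((m + 1 : ℕ) : ℂ) = qpow σ m * qpow σ 1 := by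
    rw [Nat.cast_succ, qpow_add]
  have hz' : theta (qpow σ 1) p * theta (a * qpow σ 1) p *
      theta (b * qpow σ z * qpow σ 1) p * theta (a * qpow σ z / (qpow σ 1 * b)) p ≠ 0 := by
    convert hz using 1
    rw [ellNumberDenom, qpow_add, qpow_sub, ← mul_assoc, ← mul_div_assoc, div_div]
  have hw1 := hw (m + 1) (by simp)
  rw [smallWeightDenom_eq hb] at hw1
  -- This factor of the denominator of the column of height `m` is controlled by the weight of the
  -- cell below, or by the denominator of `[z]` if there is none.
  have hprev : theta (a * qpow σ 1 / qpow σ m ^ 2) p ≠ 0 := by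
    rcases m with _ | k
    · have h0 : qpow σ ((0 : ℕ) : ℂ) = 1 := by simp [qpow]
      rw [h0, one_pow, div_one]
      simp only [mul_ne_zero_iff] at hz'
      exact hz'.1.1.2
    · have hw2 := hw (k + 1) (by simp)
      rw [smallWeightDenom_eq hb] at hw2
      simp only [mul_ne_zero_iff] at hw2
      convert hw2.1.1 using 2
      rw [Nat.cast_succ, qpow_add]
      have := qpow_ne_zero σ k
      field_simp
  -- The substitution in the addition formula uses a square root of `a`.
  obtain ⟨A, rfl⟩ := IsAlgClosed.exists_pow_nat_eq a two_pos
  have hA : A ≠ 0 := fun h => ha (by simp [h])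
  have hadd := theta_addition (x := A * qpow σ z) (y := A / (qpow σ m * qpow σ 1))
    (u := A / qpow σ m) (v := b * qpow σ 1 / A) hp (by positivity) (by positivity)
    (by positivity) (by positivity)
  rw [columnNumber_eq hb, columnNumber_eq hb, smallWeight_eq hb, hMQ]
  generalize qpow σ 1 = Q at *
  generalize qpow σ z = X at *
  generalize qpow σ (m : ℂ) = M at *
  rw [show A * X * (A / (M * Q)) = A ^ 2 * X / (M * Q) by field_simp,
    show A * X / (A / (M * Q)) = X * (M * Q) by field_simp,
    show A / M * (b * Q / A) = b * Q ^ 2 / (M * Q) by field_simp,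
    show A / M / (b * Q / A) = A ^ 2 / (b * (M * Q)) by field_simp,
    show A * X * (b * Q / A) = b * X * Q by field_simp,
    show A * X / (b * Q / A) = A ^ 2 * X / (Q * b) by field_simp,
    show A / M * (A / (M * Q)) = A ^ 2 * Q / (M * Q) ^ 2 by field_simp,
    show A / M / (A / (M * Q)) = Q by field_simp,
    show A / (M * Q) * (b * Q / A) = b / M by field_simp,
    show A / (M * Q) / (b * Q / A) = A ^ 2 / (b * M * Q ^ 2) by field_simp,
    show A * X * (A / M) = A ^ 2 * X / M by field_simp,
    show A * X / (A / M) = X * M by field_simp] at hadd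
  rw [show A ^ 2 / (Q * M ^ 2) = A ^ 2 * Q / (M * Q) ^ 2 by field_simp] at hw1 ⊢
  simp only [mul_ne_zero_iff] at hz' hw1
  obtain ⟨⟨⟨d1, -⟩, d2⟩, d3⟩ := hz'
  obtain ⟨⟨d4, d5⟩, d6⟩ := hw1
  -- Only a rational identity in the theta values remains, so they become variables.
  generalize theta Q p = t1 at *
  generalize theta (A ^ 2 * Q / (M * Q) ^ 2) p = t2 at *
  generalize theta (b * X * Q) p = t3 at *
  generalize theta (A ^ 2 * X / (Q * b)) p = t4 at *
  generalize theta (A ^ 2 * Q / M ^ 2) p = t5 at *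
  generalize theta (b * Q ^ 2 / M) p = t6 at *
  generalize theta (A ^ 2 / (b * M)) p = t7 at *
  generalize theta (A ^ 2 * X / (M * Q)) p = t8 at *
  generalize theta (X * (M * Q)) p = t9 at *
  generalize theta (b * Q ^ 2 / (M * Q)) p = t10 at *
  generalize theta (A ^ 2 / (b * (M * Q))) p = t11 at *
  generalize theta (b / M) p = t12 at *
  generalize theta (A ^ 2 / (b * M * Q ^ 2)) p = t13 at *
  generalize theta (A ^ 2 * X / M) p = t14 at *
  generalize theta (X * M) p = t15 at *
  field_simp
  linear_combination hadd

/-- The expansion of a column over the position `c` of its rook, where `c = 0` stands for a column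
without a rook. -/
lemma columnNumber_eq_sum {a b σ p z : ℂ} (ha : a ≠ 0) (hb : b ≠ 0) (hp : ‖p‖ < 1)
    (hz : ellNumberDenom a b σ p z ≠ 0) {m : ℕ}
    (hw : ∀ j ∈ Icc 1 m, smallWeightDenom a b σ p 1 (1 - (j : ℤ)) ≠ 0) :
    columnNumber a b σ p z m =
      ∑ c ∈ range (m + 1), (∏ j ∈ Ioc c m, smallWeight a b σ p 1 (1 - (j : ℤ))) *
        if c = 0 then ellNumber a b σ p z else 1 := by
  induction m with
  | zero => simp [columnNumber_zero]
  | succ m ih =>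
    rw [columnNumber_succ ha hb hp hz hw, sum_range_succ,
      ih fun j hj => hw j (Icc_subset_Icc_right m.le_succ hj), mul_sum]
    congr 1
    · refine sum_congr rfl fun c hc => ?_
      rw [← insert_Ioc_right_eq_Ioc_add_one (by have := mem_range.mp hc; omega),
        prod_insert (by simp), mul_assoc]
    · simp

/-! ### File placements -/

/-- The placement with one rook in row `r i` of column `i + 1` for each `i` with `r i ≠ 0`, and no
other rooks. -/
def rooks {n : ℕ} (r : Fin n → ℕ) : Finset (ℕ × ℕ) :=
  (univ.filter fun i : Fin n => r i ≠ 0).image fun i : Fin n => ((i : ℕ) + 1, r i)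

lemma mem_rooks {n : ℕ} {r : Fin n → ℕ} {c : ℕ × ℕ} :
    c ∈ rooks r ↔ ∃ i : Fin n, r i ≠ 0 ∧ c = ((i : ℕ) + 1, r i) := by
  simp only [rooks, mem_image, mem_filter, mem_univ, true_and, eq_comm (b := c)]

lemma mk_mem_rooks {n : ℕ} {r : Fin n → ℕ} {i : Fin n} {j : ℕ} :
    ((i : ℕ) + 1, j) ∈ rooks r ↔ j ≠ 0 ∧ j = r i := by
  rw [mem_rooks]
  constructor
  · rintro ⟨k, hk, hik⟩
    simp only [Prod.mk.injEq] at hik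
    obtain rfl : i = k := Fin.ext (by omega)
    exact ⟨hik.2 ▸ hk, hik.2⟩
  · rintro ⟨hj, rfl⟩
    exact ⟨i, hj, rfl⟩

lemma mem_board {n : ℕ} {h : Fin n → ℕ} {c : ℕ × ℕ} :
    c ∈ board h ↔ ∃ (i : Fin n) (j : ℕ), j ∈ Icc 1 (h i) ∧ c = ((i : ℕ) + 1, j) := by
  simp only [board, mem_biUnion, mem_univ, true_and, mem_image, eq_comm (b := c)]

lemma mk_mem_board {n : ℕ} {h : Fin n → ℕ} {i : Fin n} {j : ℕ} :
    ((i : ℕ) + 1, j) ∈ board h ↔ j ∈ Icc 1 (h i) := by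
  rw [mem_board]
  constructor
  · rintro ⟨k, l, hl, hik⟩
    simp only [Prod.mk.injEq] at hik
    obtain rfl : i = k := Fin.ext (by omega)
    exact hik.2 ▸ hl
  · exact fun hj => ⟨i, j, hj, rfl⟩

lemma card_rooks {n : ℕ} (r : Fin n → ℕ) :
    (rooks r).card = (univ.filter fun i : Fin n => r i ≠ 0).card := by
  refine card_image_of_injective _ fun i k hik => ?_
  simp only [Prod.mk.injEq] at hik
  exact Fin.ext (by omega)

lemma rooks_injective {n : ℕ} : Function.Injective (rooks (n := n)) := by
  intro r r' h
  funext i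
  have key : ∀ j, (j ≠ 0 ∧ j = r i) ↔ (j ≠ 0 ∧ j = r' i) := fun j => by
    rw [← mk_mem_rooks, ← mk_mem_rooks, h]
  have h1 := key (r i)
  have h2 := key (r' i)
  omega

/-- All file placements in `B`, with any number of rooks. -/
def allFilePlacements (B : Finset (ℕ × ℕ)) : Finset (Finset (ℕ × ℕ)) :=
  {Q ∈ B.powerset | ∀ c ∈ Q, ∀ d ∈ Q, c.1 = d.1 → c = d}

lemma filePlacements_eq_filter (B : Finset (ℕ × ℕ)) (k : ℕ) :
    filePlacements B k = {Q ∈ allFilePlacements B | Q.card = k} := by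
  ext Q
  simp only [filePlacements, allFilePlacements, mem_filter, mem_powersetCard, mem_powerset]
  tauto

/-- A file placement amounts to choosing, in each column, a row for the rook or no rook. -/
lemma allFilePlacements_board {n : ℕ} (h : Fin n → ℕ) :
    allFilePlacements (board h) =
      (Fintype.piFinset fun i => range (h i + 1)).image rooks := by
  ext Q
  simp only [allFilePlacements, mem_filter, mem_powerset, mem_image, Fintype.mem_piFinset,
    mem_range]
  constructor
  · rintro ⟨hQ, hcol⟩
    have hrow : ∀ i : Fin n, ∃ m, m < h i + 1 ∧ ∀ j, ((i : ℕ) + 1, j) ∈ Q ↔ j ≠ 0 ∧ j = m := by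
      intro i
      by_cases hi : ∃ j, ((i : ℕ) + 1, j) ∈ Q
      · obtain ⟨m, hm⟩ := hi
        have hmh := mem_Icc.mp (mk_mem_board.mp (hQ hm))
        refine ⟨m, by omega, fun j => ⟨fun hj => ?_, ?_⟩⟩
        · have hjm : j = m := congrArg Prod.snd (hcol _ hj _ hm rfl)
          exact ⟨by omega, hjm⟩
        · rintro ⟨-, rfl⟩
          exact hm
      · exact ⟨0, Nat.succ_pos _, fun j =>
          ⟨fun hj => (hi ⟨j, hj⟩).elim, fun hj => (hj.1 hj.2).elim⟩⟩
    choose r hr hrQ using hrow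
    refine ⟨r, hr, ?_⟩
    ext c
    constructor
    · intro hc
      obtain ⟨i, hi, rfl⟩ := mem_rooks.mp hc
      exact (hrQ i _).mpr ⟨hi, rfl⟩
    · intro hc
      obtain ⟨i, j, -, rfl⟩ := mem_board.mp (hQ hc)
      exact mk_mem_rooks.mpr ((hrQ i j).mp hc)
  · rintro ⟨r, hr, rfl⟩
    refine ⟨fun c hc => ?_, fun c hc d hd hcd => ?_⟩
    · obtain ⟨i, hi, rfl⟩ := mem_rooks.mp hc
      have := hr i
      exact mk_mem_board.mpr (mem_Icc.mpr (by omega))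
    · obtain ⟨i, hi, rfl⟩ := mem_rooks.mp hc
      obtain ⟨k, hk, rfl⟩ := mem_rooks.mp hd
      obtain rfl : i = k := Fin.ext (Nat.succ_injective hcd)
      rfl

/-- The uncancelled cells of a column are those above the row of its rook; with no rook this row
is `0`, so all cells are uncancelled. -/
lemma uncancelled_rooks {n : ℕ} (h r : Fin n → ℕ) :
    uncancelled (board h) (rooks r) =
      univ.biUnion fun i : Fin n => (Ioc (r i) (h i)).image fun j => ((i : ℕ) + 1, j) := by
  ext c
  simp only [uncancelled, mem_filter, mem_biUnion, mem_univ, true_and, mem_image]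
  constructor
  · rintro ⟨hc, hcQ, hcan⟩
    obtain ⟨i, j, hj, rfl⟩ := mem_board.mp hc
    refine ⟨i, j, mem_Ioc.mpr ?_, rfl⟩
    rw [mem_Icc] at hj
    rw [mk_mem_rooks] at hcQ
    refine ⟨?_, hj.2⟩
    by_contra hlt
    have hrook : ((i : ℕ) + 1, r i) ∈ rooks r := mk_mem_rooks.mpr ⟨by omega, rfl⟩
    exact hcan _ hrook ⟨rfl, show j < r i by omega⟩
  · rintro ⟨i, j, hj, rfl⟩
    rw [mem_Ioc] at hj
    refine ⟨mk_mem_board.mpr (mem_Icc.mpr (by omega)), ?_, ?_⟩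
    · rw [mk_mem_rooks]
      omega
    · rintro d hd ⟨hd1, hd2⟩
      obtain ⟨k, -, rfl⟩ := mem_rooks.mp hd
      obtain rfl : k = i := Fin.ext (Nat.succ_injective hd1)
      exact absurd hd2 (by simp only [not_lt]; omega)

lemma prod_uncancelled_rooks {n : ℕ} (h r : Fin n → ℕ) (f : ℕ → ℂ) :
    ∏ c ∈ uncancelled (board h) (rooks r), f c.2 = ∏ i, ∏ j ∈ Ioc (r i) (h i), f j := by
  rw [uncancelled_rooks, prod_biUnion]
  · refine prod_congr rfl fun i _ => ?_
    rw [prod_image fun j _ k _ hjk => congrArg Prod.snd hjk]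
  · intro i _ k _ hik
    rw [Function.onFun, disjoint_left]
    intro c hc hd
    obtain ⟨j, -, rfl⟩ := mem_image.mp hc
    obtain ⟨l, -, hl⟩ := mem_image.mp hd
    exact hik (Fin.ext (Nat.succ_injective (congrArg Prod.fst hl)).symm)

/-- The generating function of the elliptic file numbers as a sum over the choices of rows. -/
lemma sum_fileNumber {n : ℕ} (a b σ p Z : ℂ) (h : Fin n → ℕ) :
    ∑ k ∈ range (n + 1), fileNumber a b σ p (board h) (n - k) * Z ^ k =
      ∑ r ∈ Fintype.piFinset fun i => range (h i + 1),
        ∏ i, ((∏ j ∈ Ioc (r i) (h i), smallWeight a b σ p 1 (1 - (j : ℤ))) *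
          if r i = 0 then Z else 1) := by
  have hcard : ∀ Q ∈ allFilePlacements (board h), Q.card ≤ n := by
    intro Q hQ
    rw [allFilePlacements_board] at hQ
    obtain ⟨r, -, rfl⟩ := mem_image.mp hQ
    rw [card_rooks]
    exact (card_filter_le _ _).trans_eq (card_fin n)
  have hterm : ∀ r : Fin n → ℕ,
      ∏ i, ((∏ j ∈ Ioc (r i) (h i), smallWeight a b σ p 1 (1 - (j : ℤ))) *
          if r i = 0 then Z else 1) =
        (∏ c ∈ uncancelled (board h) (rooks r), smallWeight a b σ p 1 (1 - (c.2 : ℤ))) *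
          Z ^ (n - (rooks r).card) := by
    intro r
    rw [prod_mul_distrib, prod_uncancelled_rooks h r fun j => smallWeight a b σ p 1 (1 - (j : ℤ)),
      prod_ite, prod_const, prod_const_one, mul_one, card_rooks]
    congr 2
    have := card_filter_add_card_filter_not (s := (univ : Finset (Fin n))) (fun i => r i = 0)
    rw [card_fin] at this
    simp only [ne_eq]
    omega
  rw [sum_congr rfl fun r _ => hterm r,
    ← sum_image (s := Fintype.piFinset fun i => range (h i + 1)) (g := rooks)
      (f := fun Q => (∏ c ∈ uncancelled (board h) Q, smallWeight a b σ p 1 (1 - (c.2 : ℤ))) *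
        Z ^ (n - Q.card)) rooks_injective.injOn,
    ← allFilePlacements_board,
    ← sum_fiberwise_of_maps_to (t := range (n + 1)) (g := fun Q : Finset (ℕ × ℕ) => n - Q.card)
      fun Q _ => mem_range.mpr (by omega)]
  refine sum_congr rfl fun k hk => ?_
  rw [fileNumber, filePlacements_eq_filter, sum_mul]
  refine sum_congr (filter_congr fun Q hQ => ?_) fun Q hQ => ?_
  · have := hcard Q hQ
    rw [mem_range] at hk
    omega
  · rw [(mem_filter.mp hQ).2]

end EllipticFile

theorem mainTheorem4 (a b σ p z : ℂ) (ha : a ≠ 0) (hb : b ≠ 0) (hp : ‖p‖ < 1)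
    (n : ℕ) (h : Fin n → ℕ) (hmono : Monotone h) (hle : ∀ i, h i ≤ n)
    (hz : EllipticFile.ellNumberDenom a b σ p z ≠ 0)
    (hw : ∀ c ∈ EllipticFile.board h,
      EllipticFile.smallWeightDenom a b σ p 1 (1 - (c.2 : ℤ)) ≠ 0) :
    ∏ i : Fin n,
        EllipticFile.ellNumber
          (a * EllipticFile.qpow σ (-2 * (h i : ℂ))) (b * EllipticFile.qpow σ (-(h i : ℂ)))
          σ p (z + (h i : ℂ)) =
      ∑ k ∈ Finset.range (n + 1),
        EllipticFile.fileNumber a b σ p (EllipticFile.board h) (n - k) *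
          EllipticFile.ellNumber a b σ p z ^ k := by
  rw [EllipticFile.sum_fileNumber, ← Finset.prod_univ_sum (fun i => Finset.range (h i + 1))
    fun i c => (∏ j ∈ Finset.Ioc c (h i), EllipticFile.smallWeight a b σ p 1 (1 - (j : ℤ))) *
      if c = 0 then EllipticFile.ellNumber a b σ p z else 1]
  refine Finset.prod_congr rfl fun i _ => ?_
  exact EllipticFile.columnNumber_eq_sum ha hb hp hz fun j hj =>
    hw ((i : ℕ) + 1, j) (EllipticFile.mk_mem_board.mpr hj)
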